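/- Let $n\ge 1$ and let $\mathbf m=(m_1,\dots,m_n)$ be nonnegative integers, with $N=\sum_{i=1}^n m_i\geq 1$. A deck with multiplicities $\mathbf m$ is a word $(Z_1,\dots,Z_N)$ in the letters (types) $\{1,\dots,n\}$ in which each type $i$ occurs exactly $m_i$ times; $Z_s$ is the $s$-th card counted from the bottom. Let $m=N/n$ be the average multiplicity, $m^*=\max_i m_i$, and $$\beta_k=\frac1n\sum_{i=1}^n\frac1{m^k}\binom{m_i}{k}.$$ Let $\mathbf Z=(Z_1,\dots,Z_N)$ be a uniformly random deck with multiplicities $\mathbf m$, and for $1\le j\le m^*-1$ let $$T_j=\max\Bigl\{1\le t\le N:\ \max_{1\le i\le n}\bigl|\{1\le s\le t: Z_s=i\}\bigr|\le j\Bigr\}$$ be the last time, counting from the bottom of the deck, at which no type has appeared more than $j$ times. **Theorem.** For every integer $j\ge1$ and every $\epsilon>0$ there are constants $C_1,C_2>0$, depending only on $j$ and $\epsilon$, such that the following holds. Let $\mathbf m$ be multiplicities with $j\le m^*-1$ and let $t$ be an integer with $1\le t\le N$. Assume that $m\ge\epsilon m^*$, and that the fraction of cards of types that appear with multiplicity at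 least $\min(2j+1,m^*)$ is at least $\epsilon$, i.e. $\frac1N\sum_{i:\,m_i\ge\min(2j+1,m^*)}m_i\ge\epsilon$. Put $$\lambda=\frac{t^{j+1}}{n^j}\,\beta_{j+1}.$$ Then $$\bigl|\mathbb P(T_j\ge t)-e^{-\lambda}\bigr|\le C_1\,\frac tn\le C_2\Bigl(\frac\lambda n\Bigr)^{\frac1{j+1}}.$$ In other words, $|\mathbb P(T_j\geq t)-e^{-\lambda}|=O(t/n)=O((\lambda/n)^{1/(j+1)})$ with implicit constants depending only on $j$ and $\epsilon$. -/

import Mathlib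

namespace CardDeck

/-- The total number `N = ∑ i, m i` of cards of a deck with multiplicities `m`. -/
abbrev size {n : ℕ} (m : Fin n → ℕ) : ℕ := ∑ i, m i

/-- The largest multiplicity `m*`. -/
def maxMult {n : ℕ} (m : Fin n → ℕ) : ℕ := Finset.univ.sup m

/-- The average multiplicity `N / n`. -/
noncomputable def avgMult {n : ℕ} (m : Fin n → ℕ) : ℝ := (size m : ℝ) / (n : ℝ)

/-- `β_j = (1/n) ∑ i, (1 / avg^j) * (m i choose j)`, where `avg` is the average multiplicity. -/
noncomputable def beta {n : ℕ} (m : Fin n → ℕ) (j : ℕ) : ℝ :=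
  (1 / (n : ℝ)) * ∑ i, (1 / avgMult m ^ j) * ((m i).choose j : ℝ)

/-- The fraction of the cards of the deck whose type appears with multiplicity at least `k`. -/
noncomputable def cardFraction {n : ℕ} (m : Fin n → ℕ) (k : ℕ) : ℝ :=
  ((∑ i with k ≤ m i, m i : ℕ) : ℝ) / (size m : ℝ)

/-- The decks with multiplicities `m`: words of length `N` in the letters `Fin n` in which the
letter `i` occurs exactly `m i` times. The entry `Z s` is the card at time `s + 1`, counting from
the bottom of the deck. -/
def decks {n : ℕ} (m : Fin n → ℕ) : Set (Fin (size m) → Fin n) :=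
  {Z | ∀ i, (Finset.univ.filter fun s => Z s = i).card = m i}

/-- The law of a uniformly random deck with multiplicities `m`. -/
noncomputable def deckMeasure {n : ℕ} (m : Fin n → ℕ) :
    MeasureTheory.Measure (Fin (size m) → Fin n) :=
  ProbabilityTheory.uniformOn (decks m)

/-- The number of cards of type `i` among the cards at times `1, …, t`. -/
def countUpTo {n N : ℕ} (Z : Fin N → Fin n) (t : ℕ) (i : Fin n) : ℕ :=
  (Finset.univ.filter fun s : Fin N => s.val + 1 ≤ t ∧ Z s = i).card

/-- `T_j`: the last time `t` in `{1, …, N}` such that no type appears more than `j` times among the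
cards at times `1, …, t`. (For `j ≥ 1` and `N ≥ 1` the time `1` always qualifies.) -/
def lastTime {n N : ℕ} (Z : Fin N → Fin n) (j : ℕ) : ℕ :=
  ((Finset.Icc 1 N).filter fun t => ∀ i, countUpTo Z t i ≤ j).sup id

theorem decks_nonempty {n : ℕ} (m : Fin n → ℕ) : (decks m).Nonempty := by
  refine ⟨fun s => (finSigmaFinEquiv.symm s).1, fun i => ?_⟩
  have h : (Finset.univ.filter fun s : Fin (size m) => (finSigmaFinEquiv.symm s).1 = i)
      = (Finset.univ : Finset (Fin (m i))).image fun k => finSigmaFinEquiv ⟨i, k⟩ := by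
    ext s
    simp only [Finset.mem_filter, Finset.mem_univ, true_and, Finset.mem_image]
    constructor
    · rintro rfl
      exact ⟨(finSigmaFinEquiv.symm s).2, finSigmaFinEquiv.apply_symm_apply s⟩
    · rintro ⟨k, rfl⟩
      simp
  rw [h, Finset.card_image_of_injective _ (fun a b hab => by simpa using hab)]
  simp

instance {n : ℕ} (m : Fin n → ℕ) : MeasureTheory.IsProbabilityMeasure (deckMeasure m) :=
  ProbabilityTheory.isProbabilityMeasure_uniformOn (Set.toFinite _) (decks_nonempty m)

end CardDeck

namespace CardDeck

open Polynomial

/-! Label the N cards so that they become distinguishable. The bottom t cards then form a uniform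
t-subset, so P(T_j ≥ t) = e_t / C(N, t), where e_t counts the t-subsets with at most j cards of each
type (`deckMeasure_real_le_lastTime`). The generating polynomial of e is the product over i of the
truncations of (1 + X)^(m_i) at degree j. Each truncation satisfies (1 + X) p' = m_i p up to one
monomial of degree j, and the product rule gives (s + 1) e_{s+1} = (N - s) e_s - D_s
(`succ_mul_coeff_succ_goodPoly`). Hence, as long as x = m* t / N is small, P(T_j ≥ t) is exactly the
product over s < t of 1 - h_s, with h_s = D_s / ((N - s) e_s).

With B the sum of the C(m_i, j + 1), one expects h_s ≈ (j + 1) B s(s-1)...(s-j+1) / N^(j+1), whose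
sum over s < t is about B (t/N)^(j+1) = λ. The relative error is O(x): the induction
`goodPoly_crude` bounds the ratios e_r / e_{r+1} and h_s roughly, and `hazard_le_rate` and
`rate_le_hazard` refine this. The exponent is then λ + O(x + xλ), and the term xλ is harmless
because λ exp(-λ/2) is bounded. When x is not small the claim is trivial.

Finally m ≥ ε m* gives x ≤ t / (ε n), and a power mean inequality bounds β_{j+1} below (`le_beta`),
which gives the second inequality. -/

/-! ### Truncated binomial polynomials and their products -/

/-- The polynomial `∑ k ≤ j, (a choose k) X ^ k`. -/
noncomputable def truncBinom (j a : ℕ) : ℝ[X] :=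
  ∑ k ∈ Finset.range (j + 1), C (a.choose k : ℝ) * X ^ k

theorem coeff_truncBinom (j a k : ℕ) :
    (truncBinom j a).coeff k = if k ≤ j then (a.choose k : ℝ) else 0 := by
  simp [truncBinom, coeff_X_pow]

theorem succ_mul_choose_succ_add (a s : ℕ) :
    ((s : ℝ) + 1) * (a.choose (s + 1) : ℝ) + s * (a.choose s : ℝ) = a * (a.choose s : ℝ) := by
  have h := Nat.choose_succ_right_eq a s
  rcases le_or_gt s a with hs | hs
  · have h' : ((a.choose (s + 1) * (s + 1) : ℕ) : ℝ) = ((a.choose s * (a - s) : ℕ) : ℝ) := by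
      rw [h]
    push_cast [Nat.cast_sub hs] at h'
    linarith
  · simp [Nat.choose_eq_zero_of_lt hs, Nat.choose_eq_zero_of_lt (Nat.lt_succ_of_lt hs)]

/-- The full polynomial (1 + X)^a solves (1 + X) p' = a p. Truncation breaks this only in degree j,
where the contribution of the missing term of degree j + 1 is lost. -/
theorem one_add_X_mul_derivative_truncBinom (j a : ℕ) :
    (1 + X) * derivative (truncBinom j a)
      = C (a : ℝ) * truncBinom j a - C (((j : ℝ) + 1) * (a.choose (j + 1) : ℝ)) * X ^ j := by
  ext s
  rw [add_mul, one_mul, coeff_add, coeff_derivative, coeff_sub, coeff_C_mul, coeff_C_mul_X_pow]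
  have hX : (X * derivative (truncBinom j a)).coeff s = (truncBinom j a).coeff s * s := by
    cases s with
    | zero => simp
    | succ s => rw [coeff_X_mul, coeff_derivative]; push_cast; ring
  rw [hX]
  simp only [coeff_truncBinom]
  have key := succ_mul_choose_succ_add a s
  rcases lt_trichotomy s j with h | h | h
  · rw [if_pos (by omega), if_pos (by omega), if_neg (by omega)]; linarith
  · subst h
    rw [if_neg (by omega), if_pos le_rfl, if_pos rfl]; linarith
  · rw [if_neg (by omega), if_neg (by omega), if_neg (by omega)]; ring

theorem coeff_mul_nonneg {p q : ℝ[X]} (hp : ∀ k, 0 ≤ p.coeff k) (hq : ∀ k, 0 ≤ q.coeff k) (k : ℕ) :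
    0 ≤ (p * q).coeff k := by
  rw [coeff_mul]
  exact Finset.sum_nonneg fun x _ => mul_nonneg (hp _) (hq _)

theorem coeff_prod_nonneg {ι : Type*} (s : Finset ι) (p : ι → ℝ[X])
    (hp : ∀ i ∈ s, ∀ k, 0 ≤ (p i).coeff k) : ∀ k, 0 ≤ (∏ i ∈ s, p i).coeff k :=
  Finset.prod_induction p (fun q => ∀ k, 0 ≤ q.coeff k) (fun _ _ => coeff_mul_nonneg)
    (fun k => by rw [coeff_one]; split_ifs <;> norm_num) hp

theorem coeff_truncBinom_nonneg (j a k : ℕ) : 0 ≤ (truncBinom j a).coeff k := by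
  rw [coeff_truncBinom]; split_ifs <;> positivity

/-- The generating polynomial of sets of cards with at most `j` cards of each type. -/
noncomputable def goodPoly {n : ℕ} (m : Fin n → ℕ) (j : ℕ) : ℝ[X] :=
  ∏ i, truncBinom j (m i)

/-- The analogue of `goodPoly` for the deck from which type `i` has been removed. -/
noncomputable def goodPolyErase {n : ℕ} (m : Fin n → ℕ) (j : ℕ) (i : Fin n) : ℝ[X] :=
  ∏ l ∈ Finset.univ.erase i, truncBinom j (m l)

theorem truncBinom_mul_goodPolyErase {n : ℕ} (m : Fin n → ℕ) (j : ℕ) (i : Fin n) :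
    truncBinom j (m i) * goodPolyErase m j i = goodPoly m j := by
  rw [goodPolyErase, goodPoly]
  exact Finset.mul_prod_erase Finset.univ (fun l => truncBinom j (m l)) (Finset.mem_univ i)

theorem coeff_goodPoly_nonneg {n : ℕ} (m : Fin n → ℕ) (j k : ℕ) : 0 ≤ (goodPoly m j).coeff k :=
  coeff_prod_nonneg _ _ (fun _ _ => coeff_truncBinom_nonneg _ _) k

theorem coeff_goodPolyErase_nonneg {n : ℕ} (m : Fin n → ℕ) (j : ℕ) (i : Fin n) (k : ℕ) :
    0 ≤ (goodPolyErase m j i).coeff k :=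
  coeff_prod_nonneg _ _ (fun _ _ => coeff_truncBinom_nonneg _ _) k

theorem coeff_zero_truncBinom (j a : ℕ) : (truncBinom j a).coeff 0 = 1 := by
  simp [coeff_truncBinom]

theorem coeff_zero_goodPoly {n : ℕ} (m : Fin n → ℕ) (j : ℕ) : (goodPoly m j).coeff 0 = 1 := by
  simp [goodPoly, coeff_zero_prod, coeff_zero_truncBinom]

theorem coeff_zero_goodPolyErase {n : ℕ} (m : Fin n → ℕ) (j : ℕ) (i : Fin n) :
    (goodPolyErase m j i).coeff 0 = 1 := by
  simp [goodPolyErase, coeff_zero_prod, coeff_zero_truncBinom]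

theorem coeff_goodPolyErase_le {n : ℕ} (m : Fin n → ℕ) (j : ℕ) (i : Fin n) (r : ℕ) :
    (goodPolyErase m j i).coeff r ≤ (goodPoly m j).coeff r := by
  rw [← truncBinom_mul_goodPolyErase m j i, coeff_mul]
  have h := Finset.single_le_sum
    (f := fun x : ℕ × ℕ => (truncBinom j (m i)).coeff x.1 * (goodPolyErase m j i).coeff x.2)
    (s := Finset.HasAntidiagonal.antidiagonal r) (fun x _ => mul_nonneg (coeff_truncBinom_nonneg _ _ _)
      (coeff_goodPolyErase_nonneg _ _ _ _)) (show (0, r) ∈ _ by simp)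
  simpa [coeff_zero_truncBinom] using h

/-- A good set of size r + 1 either avoids type i or arises from a good set of size r by adding one
of the m_i cards of type i. Algebraically, m_i X p - p + 1 has nonnegative coefficients, where p is
the truncated binomial of type i. -/
theorem coeff_succ_goodPoly_le {n : ℕ} (m : Fin n → ℕ) (j : ℕ) (i : Fin n) (r : ℕ) :
    (goodPoly m j).coeff (r + 1)
      ≤ (goodPolyErase m j i).coeff (r + 1) + m i * (goodPoly m j).coeff r := by
  have h : 0 ≤ ((C (m i : ℝ) * X * truncBinom j (m i) - truncBinom j (m i) + 1)
      * goodPolyErase m j i).coeff (r + 1) := by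
    refine coeff_mul_nonneg (fun k => ?_) (coeff_goodPolyErase_nonneg m j i) _
    cases k with
    | zero => simp [coeff_zero_truncBinom, mul_assoc]
    | succ k =>
      have h1 : (C (m i : ℝ) * X * truncBinom j (m i)).coeff (k + 1)
          = m i * (truncBinom j (m i)).coeff k := by
        rw [mul_assoc, coeff_C_mul, coeff_X_mul]
      rw [coeff_add, coeff_sub, h1, coeff_one, if_neg (Nat.succ_ne_zero k), coeff_truncBinom,
        coeff_truncBinom]
      have key := succ_mul_choose_succ_add (m i) k
      have h2 : (0 : ℝ) ≤ k * ((m i).choose (k + 1) : ℝ) := by positivity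
      have h3 : (0 : ℝ) ≤ k * ((m i).choose k : ℝ) := by positivity
      have h4 : (0 : ℝ) ≤ m i * ((m i).choose k : ℝ) := by positivity
      split_ifs with h5 h6 h6
      · linarith
      · linarith
      · exact absurd (Nat.le_of_succ_le h6) h5
      · simp
  have e : (C (m i : ℝ) * X * truncBinom j (m i) - truncBinom j (m i) + 1) * goodPolyErase m j i
      = C (m i : ℝ) * (X * goodPoly m j) - goodPoly m j + goodPolyErase m j i := by
    rw [← truncBinom_mul_goodPolyErase m j i]; ring
  rw [e, coeff_add, coeff_sub, coeff_C_mul, coeff_X_mul] at h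
  linarith

/-! ### Recurrence for the number of good sets -/

/-- The weighted number of pairs of a good set of `s` cards and a further card that spoils it. -/
noncomputable def spoilCount {n : ℕ} (m : Fin n → ℕ) (j s : ℕ) : ℝ :=
  ∑ i, ((j : ℝ) + 1) * ((m i).choose (j + 1) : ℝ) * (goodPolyErase m j i * X ^ j).coeff s

/-- This is the coefficient of X^s in the differential equation for the product. It also counts the
ways to add a card to a good set of size s: N - s cards are available, and those that spoil the set
are removed. -/
theorem succ_mul_coeff_succ_goodPoly {n : ℕ} (m : Fin n → ℕ) (j s : ℕ) :
    ((s : ℝ) + 1) * (goodPoly m j).coeff (s + 1)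
      = ((size m : ℝ) - s) * (goodPoly m j).coeff s - spoilCount m j s := by
  have h : (1 + X) * derivative (goodPoly m j) = C (size m : ℝ) * goodPoly m j
      - ∑ i, C (((j : ℝ) + 1) * ((m i).choose (j + 1) : ℝ)) * (goodPolyErase m j i * X ^ j) := by
    have h1 : derivative (goodPoly m j)
        = ∑ i, goodPolyErase m j i * derivative (truncBinom j (m i)) := by
      rw [goodPoly, derivative_prod_finset]; rfl
    rw [h1, Finset.mul_sum]
    have h2 : C (size m : ℝ) * goodPoly m j = ∑ i, C (m i : ℝ) * goodPoly m j := by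
      rw [← Finset.sum_mul, ← map_sum, Nat.cast_sum]
    rw [h2, ← Finset.sum_sub_distrib]
    refine Finset.sum_congr rfl fun i _ => ?_
    rw [mul_left_comm, one_add_X_mul_derivative_truncBinom,
      ← truncBinom_mul_goodPolyErase m j i]
    ring
  have hc := congrArg (fun p => coeff p s) h
  have hX : (X * derivative (goodPoly m j)).coeff s = (goodPoly m j).coeff s * s := by
    cases s with
    | zero => simp
    | succ s => rw [coeff_X_mul, coeff_derivative]; push_cast; ring
  simp only [add_mul, one_mul, coeff_add, coeff_sub, hX, coeff_derivative, coeff_C_mul,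
    finsetSum_coeff] at hc
  simp only [spoilCount, add_mul, one_mul]
  linarith

theorem spoilCount_of_lt {n : ℕ} (m : Fin n → ℕ) {j s : ℕ} (h : s < j) : spoilCount m j s = 0 :=
  Finset.sum_eq_zero fun i _ => by rw [coeff_mul_X_pow', if_neg (by omega), mul_zero]

theorem spoilCount_nonneg {n : ℕ} (m : Fin n → ℕ) (j s : ℕ) : 0 ≤ spoilCount m j s :=
  Finset.sum_nonneg fun i _ => mul_nonneg (by positivity)
    (coeff_mul_nonneg (coeff_goodPolyErase_nonneg m j i)
      (fun k => by rw [coeff_X_pow]; split_ifs <;> norm_num) _)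

theorem spoilCount_add_le {n : ℕ} (m : Fin n → ℕ) (j r : ℕ) :
    spoilCount m j (r + j)
      ≤ ((j : ℝ) + 1) * (∑ i, ((m i).choose (j + 1) : ℝ)) * (goodPoly m j).coeff r := by
  rw [Finset.mul_sum, Finset.sum_mul, spoilCount]
  refine Finset.sum_le_sum fun i _ => ?_
  rw [coeff_mul_X_pow]
  exact mul_le_mul_of_nonneg_left (coeff_goodPolyErase_le m j i r) (by positivity)

theorem le_spoilCount_add {n : ℕ} (m : Fin n → ℕ) (j r : ℕ) (x : ℝ)
    (h : ∀ i, x ≤ (goodPolyErase m j i).coeff r) :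
    ((j : ℝ) + 1) * (∑ i, ((m i).choose (j + 1) : ℝ)) * x ≤ spoilCount m j (r + j) := by
  rw [Finset.mul_sum, Finset.sum_mul, spoilCount]
  refine Finset.sum_le_sum fun i _ => ?_
  rw [coeff_mul_X_pow]
  exact mul_le_mul_of_nonneg_left (h i) (by positivity)

/-! ### Elementary inequalities -/

/-- The right side is the chord over [0, 1] of a convex function of x; the induction only needs x² ≤
x. -/
theorem one_add_mul_pow_le {a x : ℝ} (ha : 0 ≤ a) (hx : 0 ≤ x) (hx1 : x ≤ 1) (k : ℕ) :
    (1 + a * x) ^ k ≤ 1 + ((1 + a) ^ k - 1) * x := by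
  induction k with
  | zero => simp
  | succ k ih =>
    have hA : (0 : ℝ) ≤ (1 + a) ^ k - 1 := sub_nonneg.2 (one_le_pow₀ (by linarith))
    have h1 : (1 + a * x) ^ (k + 1) ≤ (1 + ((1 + a) ^ k - 1) * x) * (1 + a * x) := by
      rw [pow_succ]; exact mul_le_mul_of_nonneg_right ih (by positivity)
    have h2 : a * ((1 + a) ^ k - 1) * (x * x) ≤ a * ((1 + a) ^ k - 1) * (x * 1) := by gcongr
    rw [pow_succ (1 + a) k]
    nlinarith

/-- The discrete analogue of integrating s^j; it evaluates the sum of the approximate hazards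
exactly. -/
theorem succ_mul_sum_descFactorial (j t : ℕ) :
    ((j : ℝ) + 1) * ∑ s ∈ Finset.range t, (s.descFactorial j : ℝ) = t.descFactorial (j + 1) := by
  induction t with
  | zero => simp
  | succ t ih =>
    rw [Finset.sum_range_succ, mul_add, ih, Nat.succ_descFactorial_succ, Nat.descFactorial_succ]
    rcases le_or_gt j t with h | h
    · push_cast [Nat.cast_sub h]; ring
    · simp [Nat.descFactorial_of_lt h]

theorem mul_pow_sub_descFactorial_le (t k : ℕ) :
    (t : ℝ) * ((t : ℝ) ^ k - t.descFactorial k) ≤ (k : ℝ) ^ 2 * (t : ℝ) ^ k := by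
  induction k with
  | zero => simp
  | succ k ih =>
    have h1 : ((t.descFactorial (k + 1) : ℕ) : ℝ) = ((t : ℝ) - k) * t.descFactorial k := by
      rw [Nat.descFactorial_succ]
      rcases le_or_gt k t with h | h
      · push_cast [Nat.cast_sub h]; ring
      · simp [Nat.descFactorial_of_lt h]
    have h2 : (t.descFactorial k : ℝ) ≤ (t : ℝ) ^ k := by
      exact_mod_cast Nat.descFactorial_le_pow t k
    have ht : (0 : ℝ) ≤ t := by positivity
    have hk : (0 : ℝ) ≤ k := by positivity
    have h3 := mul_le_mul_of_nonneg_left ih ht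
    have h4 := mul_le_mul_of_nonneg_left h2 (mul_nonneg ht hk)
    have h5 : 0 ≤ (k : ℝ) * t * (t : ℝ) ^ k := by positivity
    have h6 : 0 ≤ (t : ℝ) * (t : ℝ) ^ k := by positivity
    rw [h1, pow_succ (t : ℝ) k]
    push_cast
    nlinarith

theorem pow_succ_sub_descFactorial_succ_le (t j : ℕ) (ht : 1 ≤ t) :
    (t : ℝ) ^ (j + 1) - t.descFactorial (j + 1) ≤ ((j : ℝ) + 1) ^ 2 * (t : ℝ) ^ j := by
  have h := mul_pow_sub_descFactorial_le t (j + 1)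
  have ht' : (0 : ℝ) < t := by exact_mod_cast ht
  refine le_of_mul_le_mul_left (h.trans (le_of_eq ?_)) ht'
  push_cast; ring

/-- Products of factors `1 - h s` with small `h s` compared with exponentials. -/
theorem prod_one_sub_le_exp (h : ℕ → ℝ) (t : ℕ) (hh : ∀ s < t, 0 ≤ h s ∧ h s ≤ 1 / 2) :
    Real.exp (-∑ s ∈ Finset.range t, (h s + 2 * h s ^ 2)) ≤ ∏ s ∈ Finset.range t, (1 - h s) ∧
      ∏ s ∈ Finset.range t, (1 - h s) ≤ Real.exp (-∑ s ∈ Finset.range t, h s) := by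
  rw [← Finset.sum_neg_distrib, ← Finset.sum_neg_distrib, Real.exp_sum, Real.exp_sum]
  constructor
  · refine Finset.prod_le_prod (fun _ _ => (Real.exp_pos _).le) fun s hs => ?_
    obtain ⟨h0, h1⟩ := hh s (Finset.mem_range.1 hs)
    have hpos : 0 < 1 - h s := by linarith
    rw [← Real.le_log_iff_exp_le hpos]
    refine le_trans ?_ (Real.one_sub_inv_le_log_of_pos hpos)
    have : (1 - h s)⁻¹ ≤ 1 + h s + 2 * h s ^ 2 := by
      rw [inv_le_iff_one_le_mul₀ hpos]
      nlinarith [mul_nonneg (sq_nonneg (h s)) (sub_nonneg.2 h1)]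
    linarith
  · refine Finset.prod_le_prod (fun s hs => ?_) fun s _ => ?_
    · have := (hh s (Finset.mem_range.1 hs)).2; linarith
    · have := Real.add_one_le_exp (-h s); linarith

/-- A number between `exp (-(lam + E))` and `exp (-(lam - E))` is close to `exp (-lam)`. -/
theorem abs_sub_exp_neg_le {q lam x a K : ℝ} (hlam : 0 ≤ lam) (hx : 0 ≤ x) (hx1 : x ≤ 1)
    (ha : 0 ≤ a) (hK : 0 ≤ K) (hKx : K * x ≤ 1 / 2)
    (hl : Real.exp (-(lam + x * (a + K * lam))) ≤ q)
    (hu : q ≤ Real.exp (-(lam - x * (a + K * lam)))) :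
    |q - Real.exp (-lam)| ≤ Real.exp a * (a + 2 * K) * x := by
  set E := x * (a + K * lam) with hE
  have hE0 : 0 ≤ E := by positivity
  -- Half of `lam` is kept in reserve: the remaining factor exp(-lam/2) absorbs the term `K * lam`
  -- of `E`.
  have hEle : E ≤ a + lam / 2 := by
    have h1 : x * a ≤ 1 * a := by gcongr
    have h2 : K * x * lam ≤ 1 / 2 * lam := by gcongr
    rw [hE]; linarith
  have hub : Real.exp (-(lam - E)) - Real.exp (-lam) ≤ Real.exp (-lam) * (E * Real.exp E) := by
    have h1 : Real.exp (-(lam - E)) = Real.exp (-lam) * Real.exp E := by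
      rw [← Real.exp_add]; congr 1; ring
    have h2 := Real.add_one_le_exp (-E)
    have h3 : Real.exp (-E) * Real.exp E = 1 := by rw [← Real.exp_add]; simp
    have h4 : Real.exp E - 1 ≤ E * Real.exp E := by nlinarith [Real.exp_pos E]
    rw [h1]
    nlinarith [Real.exp_pos (-lam)]
  have hlb : Real.exp (-lam) - Real.exp (-(lam + E)) ≤ Real.exp (-lam) * (E * Real.exp E) := by
    have h1 : Real.exp (-(lam + E)) = Real.exp (-lam) * Real.exp (-E) := by
      rw [← Real.exp_add]; congr 1; ring
    have h2 := Real.add_one_le_exp (-E)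
    have h3 : 1 ≤ Real.exp E := Real.one_le_exp hE0
    have h4 : 1 - Real.exp (-E) ≤ E * Real.exp E := by nlinarith
    rw [h1]
    nlinarith [Real.exp_pos (-lam)]
  have hmain : Real.exp (-lam) * (E * Real.exp E) ≤ Real.exp a * (a + 2 * K) * x := by
    have h1 : Real.exp E ≤ Real.exp a * Real.exp (lam / 2) := by
      rw [← Real.exp_add]; exact Real.exp_le_exp.2 hEle
    have h2 : Real.exp (-lam) * Real.exp (lam / 2) = Real.exp (-(lam / 2)) := by
      rw [← Real.exp_add]; congr 1; ring
    have h3 : (a + K * lam) * Real.exp (-(lam / 2)) ≤ a + 2 * K := by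
      have h4 : lam / 2 * Real.exp (-(lam / 2)) ≤ 1 := by
        have h5 : lam / 2 ≤ Real.exp (lam / 2) := by
          have := Real.add_one_le_exp (lam / 2); linarith
        calc _ ≤ Real.exp (lam / 2) * Real.exp (-(lam / 2)) := by gcongr
          _ = 1 := by rw [← Real.exp_add]; simp
      have h6 : Real.exp (-(lam / 2)) ≤ 1 := Real.exp_le_one_iff.2 (by linarith)
      have h7 := mul_le_mul_of_nonneg_left h6 ha
      have h8 := mul_le_mul_of_nonneg_left h4 hK
      linarith
    calc Real.exp (-lam) * (E * Real.exp E)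
        ≤ Real.exp (-lam) * (E * (Real.exp a * Real.exp (lam / 2))) := by gcongr
      _ = Real.exp a * ((a + K * lam) * (Real.exp (-lam) * Real.exp (lam / 2))) * x := by
        rw [hE]; ring
      _ ≤ Real.exp a * (a + 2 * K) * x := by rw [h2]; gcongr
  rw [abs_le]
  constructor <;> linarith

/-- Chaining k one-step ratio bounds multiplies the factors s, s - 1, ..., s - k + 1. -/
theorem le_descFactorial_mul {e : ℕ → ℝ} {c : ℝ} (hc : 0 ≤ c) {s : ℕ}
    (h : ∀ r < s, e r ≤ c * ((r + 1 : ℕ) : ℝ) * e (r + 1)) {k : ℕ} (hk : k ≤ s) :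
    e (s - k) ≤ c ^ k * s.descFactorial k * e s := by
  induction k with
  | zero => simp
  | succ k ih =>
    obtain ⟨d, rfl⟩ := Nat.exists_eq_add_of_le hk
    have h1 := h d (by omega)
    have h2 := ih (by omega)
    rw [show k + 1 + d - k = d + 1 by omega] at h2
    rw [show k + 1 + d - (k + 1) = d by omega, Nat.descFactorial_succ,
      show k + 1 + d - k = d + 1 by omega]
    calc e d ≤ c * ((d + 1 : ℕ) : ℝ) * e (d + 1) := h1
      _ ≤ c * ((d + 1 : ℕ) : ℝ) * (c ^ k * (k + 1 + d).descFactorial k * e (k + 1 + d)) := by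
        gcongr
      _ = _ := by push_cast; ring

theorem descFactorial_mul_le {e : ℕ → ℝ} {c : ℝ} (hc : 0 ≤ c) {s : ℕ}
    (h : ∀ r < s, c * ((r + 1 : ℕ) : ℝ) * e (r + 1) ≤ e r) {k : ℕ} (hk : k ≤ s) :
    c ^ k * s.descFactorial k * e s ≤ e (s - k) := by
  -- No sign of `e` is assumed, so the reverse inequality follows by applying the previous one to
  -- `-e`.
  have := le_descFactorial_mul (e := fun r => -e r) hc (s := s)
    (fun r hr => by have := h r hr; linarith) hk
  linarith

/-! ### The largest share of a type and a first control of the coefficients -/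

theorem le_maxMult {n : ℕ} (m : Fin n → ℕ) (i : Fin n) : m i ≤ maxMult m :=
  Finset.le_sup (f := m) (Finset.mem_univ i)

theorem maxMult_le_size {n : ℕ} (m : Fin n → ℕ) : maxMult m ≤ size m :=
  Finset.sup_le fun _ hi => Finset.single_le_sum (f := m) (fun _ _ => Nat.zero_le _) hi

/-- The number of sets of `j + 1` cards of the same type. -/
noncomputable def sameTypeSets {n : ℕ} (m : Fin n → ℕ) (j : ℕ) : ℝ :=
  ∑ i, ((m i).choose (j + 1) : ℝ)

theorem sameTypeSets_nonneg {n : ℕ} (m : Fin n → ℕ) (j : ℕ) : 0 ≤ sameTypeSets m j :=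
  Finset.sum_nonneg fun _ _ => by positivity

theorem succ_mul_sameTypeSets_le {n : ℕ} (m : Fin n → ℕ) (j : ℕ) :
    ((j : ℝ) + 1) * sameTypeSets m j ≤ size m * (maxMult m : ℝ) ^ j := by
  rw [sameTypeSets, Finset.mul_sum, Nat.cast_sum, Finset.sum_mul]
  refine Finset.sum_le_sum fun i _ => ?_
  have h1 := succ_mul_choose_succ_add (m i) j
  have h2 : ((m i).choose j : ℝ) ≤ (maxMult m : ℝ) ^ j := by
    exact_mod_cast (Nat.choose_le_pow (m i) j).trans (Nat.pow_le_pow_left (le_maxMult m i) j)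
  have h3 : (m i : ℝ) * ((m i).choose j : ℝ) ≤ m i * (maxMult m : ℝ) ^ j := by gcongr
  have h4 : (0 : ℝ) ≤ j * ((m i).choose j : ℝ) := by positivity
  linarith

/-- The largest proportion of the deck made up of a single type. -/
noncomputable def maxShare {n : ℕ} (m : Fin n → ℕ) : ℝ := (maxMult m : ℝ) / size m

theorem maxShare_nonneg {n : ℕ} (m : Fin n → ℕ) : 0 ≤ maxShare m := by
  unfold maxShare; positivity

theorem maxShare_mul_size {n : ℕ} {m : Fin n → ℕ} (hM : 1 ≤ maxMult m) :
    maxShare m * size m = maxMult m := by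
  have : (0 : ℝ) < size m := by exact_mod_cast hM.trans (maxMult_le_size m)
  rw [maxShare, div_mul_cancel₀ _ this.ne']

/-- Since m* ≥ 1, smallness of m* s / N also makes s / N small, so a single parameter controls all
errors. -/
theorem le_maxShare_mul {n : ℕ} {m : Fin n → ℕ} (hM : 1 ≤ maxMult m) (s : ℕ) :
    (s : ℝ) ≤ maxShare m * s * size m := by
  have h : (1 : ℝ) ≤ maxMult m := by exact_mod_cast hM
  rw [mul_right_comm, maxShare_mul_size hM]
  exact le_mul_of_one_le_left (by positivity) h

theorem maxShare_mul_mono {n : ℕ} (m : Fin n → ℕ) {r s : ℕ} (h : r ≤ s) :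
    maxShare m * r ≤ maxShare m * s :=
  mul_le_mul_of_nonneg_left (by exact_mod_cast h) (maxShare_nonneg m)

/-- The three claims feed one another in an induction on s: a spoiling probability of at most 1/2
gives positivity and the ratio bound at the next size, and the ratio bound, used j times, controls
the spoiling probability there. -/
theorem goodPoly_crude {n : ℕ} {m : Fin n → ℕ} {j : ℕ} (hj : 1 ≤ j) (hM : 1 ≤ maxMult m) (s : ℕ)
    (hs : 16 * (maxShare m * s) ≤ 1) :
    0 < (goodPoly m j).coeff s ∧
      (∀ r < s, (goodPoly m j).coeff r
        ≤ 4 / size m * ((r + 1 : ℕ) : ℝ) * (goodPoly m j).coeff (r + 1)) ∧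
      spoilCount m j s ≤ 8 * (maxShare m * s) * (((size m : ℝ) - s) * (goodPoly m j).coeff s) := by
  have hN : (0 : ℝ) < size m := by exact_mod_cast hM.trans (maxMult_le_size m)
  have hμ := maxShare_nonneg m
  induction s with
  | zero =>
    refine ⟨by simp [coeff_zero_goodPoly], fun r hr => absurd hr (by omega), ?_⟩
    rw [spoilCount_of_lt m (by omega)]; simp
  | succ s ih =>
    have hmono := maxShare_mul_mono m (Nat.le_succ s)
    obtain ⟨hpos, hr, hD⟩ := ih (by linarith)
    have hsN : ((s + 1 : ℕ) : ℝ) ≤ size m / 16 := by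
      have h1 := le_maxShare_mul hM (s + 1)
      nlinarith
    have hsN' : (s : ℝ) ≤ size m / 16 := by simp only [Nat.cast_add, Nat.cast_one] at hsN; linarith
    have hrec := succ_mul_coeff_succ_goodPoly m j s
    have hstep : (size m : ℝ) / 4 * (goodPoly m j).coeff s
        ≤ ((s + 1 : ℕ) : ℝ) * (goodPoly m j).coeff (s + 1) := by
      simp only [Nat.cast_add, Nat.cast_one]
      -- At most half of the extensions are spoiled and N - s ≥ N/2, hence the factor N/4.
      have h1 : 8 * (maxShare m * s) * (((size m : ℝ) - s) * (goodPoly m j).coeff s)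
          ≤ 1 / 2 * (((size m : ℝ) - s) * (goodPoly m j).coeff s) := by
        refine mul_le_mul_of_nonneg_right (by push_cast at hs hmono; linarith) ?_
        exact mul_nonneg (by linarith) hpos.le
      have h2 : (size m : ℝ) / 2 * (goodPoly m j).coeff s
          ≤ ((size m : ℝ) - s) * (goodPoly m j).coeff s :=
        mul_le_mul_of_nonneg_right (by linarith) hpos.le
      linarith
    have hpos' : 0 < (goodPoly m j).coeff (s + 1) := by
      have h1 : 0 < (size m : ℝ) / 4 * (goodPoly m j).coeff s := by positivity
      exact pos_of_mul_pos_right (h1.trans_le hstep) (by positivity)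
    have hr' : ∀ r < s + 1, (goodPoly m j).coeff r
        ≤ 4 / size m * ((r + 1 : ℕ) : ℝ) * (goodPoly m j).coeff (r + 1) := by
      intro r hrs
      rcases Nat.lt_succ_iff_lt_or_eq.1 hrs with h | rfl
      · exact hr r h
      · have h1 := mul_le_mul_of_nonneg_left hstep (show (0 : ℝ) ≤ 4 / size m by positivity)
        have h2 : 4 / (size m : ℝ) * (size m / 4 * (goodPoly m j).coeff r)
          = (goodPoly m j).coeff r := by field_simp
        rw [h2] at h1; linarith
    refine ⟨hpos', hr', ?_⟩
    rcases lt_or_ge (s + 1) j with hlt | hge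
    · rw [spoilCount_of_lt m hlt]
      exact mul_nonneg (by positivity) (mul_nonneg (by linarith) hpos'.le)
    · have h1 := spoilCount_add_le m j (s + 1 - j)
      rw [Nat.sub_add_cancel hge] at h1
      have h2 := le_descFactorial_mul (e := (goodPoly m j).coeff) (by positivity) hr' hge
      have h3 : ((s + 1).descFactorial j : ℝ) ≤ ((s + 1 : ℕ) : ℝ) ^ j := by
        exact_mod_cast Nat.descFactorial_le_pow (s + 1) j
      set y : ℝ := maxShare m * ((s + 1 : ℕ) : ℝ) with hy
      have hy0 : 0 ≤ y := by positivity
      -- The j ratio steps produce (4y)^j, which is at most 4y because j ≥ 1 and 4y ≤ 1. Replacing N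
      -- by 2(N - s - 1) turns 4y into 8y, which closes the induction.
      calc spoilCount m j (s + 1)
          ≤ ((j : ℝ) + 1) * sameTypeSets m j * (goodPoly m j).coeff (s + 1 - j) := h1
        _ ≤ (size m * (maxMult m : ℝ) ^ j) * ((4 / size m) ^ j * ((s + 1 : ℕ) : ℝ) ^ j
            * (goodPoly m j).coeff (s + 1)) := by
          refine mul_le_mul (succ_mul_sameTypeSets_le m j) (h2.trans ?_)
            (coeff_goodPoly_nonneg _ _ _) (by positivity)
          gcongr
        _ = size m * (4 * y) ^ j * (goodPoly m j).coeff (s + 1) := by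
          rw [hy, maxShare]; simp only [mul_pow, div_pow]; ring
        _ ≤ size m * (4 * y) * (goodPoly m j).coeff (s + 1) := by
          gcongr
          exact pow_le_of_le_one (by positivity) (by linarith) (by omega)
        _ = 4 * y * (size m * (goodPoly m j).coeff (s + 1)) := by ring
        _ ≤ 4 * y * ((2 * ((size m : ℝ) - ((s + 1 : ℕ) : ℝ))) * (goodPoly m j).coeff (s + 1)) := by
          gcongr
          linarith
        _ = _ := by ring

/-! ### Two-sided estimates of the hazard -/

/-- The probability that the next card spoils a good set of `s` cards. -/
noncomputable def hazard {n : ℕ} (m : Fin n → ℕ) (j s : ℕ) : ℝ :=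
  spoilCount m j s / (((size m : ℝ) - s) * (goodPoly m j).coeff s)

theorem size_sub_mul_coeff_pos {n : ℕ} {m : Fin n → ℕ} {j : ℕ} (hj : 1 ≤ j) (hM : 1 ≤ maxMult m)
    {s : ℕ} (hs : 16 * (maxShare m * s) ≤ 1) :
    0 < ((size m : ℝ) - s) * (goodPoly m j).coeff s := by
  have hN : (0 : ℝ) < size m := by exact_mod_cast hM.trans (maxMult_le_size m)
  refine mul_pos ?_ (goodPoly_crude hj hM s hs).1
  have := le_maxShare_mul hM s
  nlinarith

theorem hazard_nonneg {n : ℕ} {m : Fin n → ℕ} {j : ℕ} (hj : 1 ≤ j) (hM : 1 ≤ maxMult m)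
    {s : ℕ} (hs : 16 * (maxShare m * s) ≤ 1) : 0 ≤ hazard m j s :=
  div_nonneg (spoilCount_nonneg m j s) (size_sub_mul_coeff_pos hj hM hs).le

theorem hazard_le {n : ℕ} {m : Fin n → ℕ} {j : ℕ} (hj : 1 ≤ j) (hM : 1 ≤ maxMult m)
    {s : ℕ} (hs : 16 * (maxShare m * s) ≤ 1) : hazard m j s ≤ 8 * (maxShare m * s) :=
  (div_le_iff₀ (size_sub_mul_coeff_pos hj hM hs)).2 (goodPoly_crude hj hM s hs).2.2

/-- The limiting intensity of the first `j + 1`-fold repetition. -/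
noncomputable def rate {n : ℕ} (m : Fin n → ℕ) (j : ℕ) : ℝ :=
  sameTypeSets m j / (size m : ℝ) ^ (j + 1)

theorem rate_nonneg {n : ℕ} (m : Fin n → ℕ) (j : ℕ) : 0 ≤ rate m j :=
  div_nonneg (sameTypeSets_nonneg m j) (by positivity)

theorem hazard_le_rate {n : ℕ} {m : Fin n → ℕ} {j : ℕ} (hj : 1 ≤ j) (hM : 1 ≤ maxMult m)
    {s : ℕ} (hs : 16 * (maxShare m * s) ≤ 1) :
    hazard m j s ≤ ((j : ℝ) + 1) * rate m j * s.descFactorial j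
      * (1 + (25 ^ (j + 1) - 1) * (maxShare m * s)) := by
  have hN : (0 : ℝ) < size m := by exact_mod_cast hM.trans (maxMult_le_size m)
  have hμ := maxShare_nonneg m
  rcases lt_or_ge s j with hlt | hge
  · simp [hazard, spoilCount_of_lt m hlt, Nat.descFactorial_of_lt hlt]
  have hden := size_sub_mul_coeff_pos hj hM hs
  have hpos := (goodPoly_crude hj hM s hs).1
  have hsN := le_maxShare_mul hM s
  set x : ℝ := maxShare m * s with hx
  have hx0 : 0 ≤ x := by positivity
  have hB := sameTypeSets_nonneg m j
  -- The crude bounds inserted into the recurrence improve the ratio constant from 4 to 1 + 24x.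
  -- Here 24 is chosen so that (1 + 24x)(1 - x)(1 - 8x) ≥ 1 for 16x ≤ 1.
  have hr : ∀ r < s, (goodPoly m j).coeff r
      ≤ (1 + 24 * x) / size m * ((r + 1 : ℕ) : ℝ) * (goodPoly m j).coeff (r + 1) := by
    intro r hrs
    have hxr : maxShare m * r ≤ x := maxShare_mul_mono m hrs.le
    have hrN := le_maxShare_mul hM r
    obtain ⟨hrp, -, hrD⟩ := goodPoly_crude hj hM r (by linarith)
    have hrec := succ_mul_coeff_succ_goodPoly m j r
    have hrN' : (r : ℝ) ≤ x * size m := hrN.trans (by gcongr)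
    have h1 : (size m : ℝ) * ((1 - x) * (1 - 8 * x)) * (goodPoly m j).coeff r
        ≤ ((r + 1 : ℕ) : ℝ) * (goodPoly m j).coeff (r + 1) := by
      simp only [Nat.cast_add, Nat.cast_one]
      have h2 : (size m : ℝ) * (1 - x) * (1 - 8 * x)
          ≤ ((size m : ℝ) - r) * (1 - 8 * (maxShare m * r)) := by
        refine mul_le_mul (by linarith) (by linarith) (by linarith) ?_
        nlinarith
      have h3 := mul_le_mul_of_nonneg_right h2 hrp.le
      linarith
    have h2 : 1 ≤ (1 + 24 * x) * ((1 - x) * (1 - 8 * x)) := by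
      have h3 := mul_nonneg hx0 hx0
      have h4 := mul_nonneg h3 hx0
      nlinarith
    calc (goodPoly m j).coeff r
        ≤ (1 + 24 * x) * ((1 - x) * (1 - 8 * x)) * (goodPoly m j).coeff r :=
          le_mul_of_one_le_left hrp.le h2
      _ = (1 + 24 * x) / size m
          * (size m * ((1 - x) * (1 - 8 * x)) * (goodPoly m j).coeff r) := by field_simp
      _ ≤ (1 + 24 * x) / size m * (((r + 1 : ℕ) : ℝ) * (goodPoly m j).coeff (r + 1)) := by gcongr
      _ = _ := by ring
  have h1 := spoilCount_add_le m j (s - j)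
  rw [Nat.sub_add_cancel hge] at h1
  have h2 := le_descFactorial_mul (e := (goodPoly m j).coeff) (by positivity) hr hge
  rw [hazard, div_le_iff₀ hden]
  have hlast : (size m : ℝ) ≤ (1 + 24 * x) * ((size m : ℝ) - s) := by
    have h3 : (size m : ℝ) * (1 - x) ≤ (size m : ℝ) - s := by linarith
    have h4 : 1 ≤ (1 + 24 * x) * (1 - x) := by nlinarith
    calc (size m : ℝ) ≤ size m * ((1 + 24 * x) * (1 - x)) := le_mul_of_one_le_right hN.le h4
      _ = (1 + 24 * x) * (size m * (1 - x)) := by ring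
      _ ≤ _ := by gcongr
  -- There are j factors 1 + 24x from the ratios and one from replacing N by N - s.
  have hpow := one_add_mul_pow_le (a := 24) (by norm_num) hx0 (by linarith) (j + 1)
  norm_num at hpow
  have hR := rate_nonneg m j
  calc spoilCount m j s
      ≤ ((j : ℝ) + 1) * sameTypeSets m j * (goodPoly m j).coeff (s - j) := h1
    _ ≤ ((j : ℝ) + 1) * sameTypeSets m j * (((1 + 24 * x) / size m) ^ j * s.descFactorial j
        * (goodPoly m j).coeff s) := by gcongr
    _ = ((j : ℝ) + 1) * rate m j * s.descFactorial j * (1 + 24 * x) ^ j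
        * (size m * (goodPoly m j).coeff s) := by
      rw [rate, div_pow, pow_succ]; field_simp
    _ ≤ ((j : ℝ) + 1) * rate m j * s.descFactorial j * (1 + 24 * x) ^ j
        * ((1 + 24 * x) * ((size m : ℝ) - s) * (goodPoly m j).coeff s) := by gcongr
    _ = ((j : ℝ) + 1) * rate m j * s.descFactorial j * (1 + 24 * x) ^ (j + 1)
        * (((size m : ℝ) - s) * (goodPoly m j).coeff s) := by rw [pow_succ]; ring
    _ ≤ _ := by gcongr

theorem rate_le_hazard {n : ℕ} {m : Fin n → ℕ} {j : ℕ} (hj : 1 ≤ j) (hM : 1 ≤ maxMult m)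
    {s : ℕ} (hs : 16 * (maxShare m * s) ≤ 1) :
    ((j : ℝ) + 1) * rate m j * s.descFactorial j * (1 - 4 * (maxShare m * s))
      ≤ hazard m j s := by
  have hN : (0 : ℝ) < size m := by exact_mod_cast hM.trans (maxMult_le_size m)
  have hμ := maxShare_nonneg m
  rcases lt_or_ge s j with hlt | hge
  · simp [hazard, spoilCount_of_lt m hlt, Nat.descFactorial_of_lt hlt]
  have hden := size_sub_mul_coeff_pos hj hM hs
  obtain ⟨hpos, hcr, -⟩ := goodPoly_crude hj hM s hs
  set x : ℝ := maxShare m * s with hx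
  have hx0 : 0 ≤ x := by positivity
  have hB := sameTypeSets_nonneg m j
  -- This direction of the ratio bound needs no smallness: the recurrence only loses nonnegative
  -- terms.
  have hr : ∀ r < s, 1 / (size m : ℝ) * ((r + 1 : ℕ) : ℝ) * (goodPoly m j).coeff (r + 1)
      ≤ (goodPoly m j).coeff r := by
    intro r _
    have hrec := succ_mul_coeff_succ_goodPoly m j r
    have h1 := spoilCount_nonneg m j r
    have h2 : (0 : ℝ) ≤ r * (goodPoly m j).coeff r :=
      mul_nonneg (by positivity) (coeff_goodPoly_nonneg m j r)
    rw [one_div, mul_assoc, inv_mul_le_iff₀ hN]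
    simp only [Nat.cast_add, Nat.cast_one]
    linarith
  have h2 := descFactorial_mul_le (e := (goodPoly m j).coeff) (by positivity) hr hge
  -- Good sets of size s - j that contain a card of type i make up at most a fraction 4x of all good
  -- sets of that size, by the crude ratio bound and m_i ≤ m*.
  have herase : ∀ i, (1 - 4 * x) * (goodPoly m j).coeff (s - j)
      ≤ (goodPolyErase m j i).coeff (s - j) := by
    intro i
    rcases Nat.eq_zero_or_eq_succ_pred (s - j) with h0 | h0
    · rw [h0, coeff_zero_goodPoly, coeff_zero_goodPolyErase]; linarith
    · set r := (s - j).pred with hrdef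
      have h3 := coeff_succ_goodPoly_le m j i r
      have h4 := hcr r (by omega)
      rw [h0, Nat.succ_eq_add_one]
      have h5 : (m i : ℝ) * (4 / size m * ((r + 1 : ℕ) : ℝ)) ≤ 4 * x := by
        have h6 : (m i : ℝ) ≤ maxMult m := by exact_mod_cast le_maxMult m i
        have h7 : ((r + 1 : ℕ) : ℝ) ≤ s := by exact_mod_cast (by omega)
        calc (m i : ℝ) * (4 / size m * ((r + 1 : ℕ) : ℝ))
            ≤ maxMult m * (4 / size m * (s : ℝ)) := by gcongr
          _ = 4 * x := by rw [hx, maxShare]; ring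
      have h6 : (m i : ℝ) * (goodPoly m j).coeff r ≤ 4 * x * (goodPoly m j).coeff (r + 1) := by
        calc (m i : ℝ) * (goodPoly m j).coeff r
            ≤ m i * (4 / size m * ((r + 1 : ℕ) : ℝ) * (goodPoly m j).coeff (r + 1)) := by gcongr
          _ = m i * (4 / size m * ((r + 1 : ℕ) : ℝ)) * (goodPoly m j).coeff (r + 1) := by ring
          _ ≤ _ := mul_le_mul_of_nonneg_right h5 (coeff_goodPoly_nonneg _ _ _)
      linarith
  have h1 := le_spoilCount_add m j (s - j) _ herase
  rw [Nat.sub_add_cancel hge] at h1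
  rw [hazard, le_div_iff₀ hden]
  have hR := rate_nonneg m j
  have hx1 : 0 ≤ 1 - 4 * x := by linarith
  calc ((j : ℝ) + 1) * rate m j * s.descFactorial j * (1 - 4 * x)
        * (((size m : ℝ) - s) * (goodPoly m j).coeff s)
      ≤ ((j : ℝ) + 1) * rate m j * s.descFactorial j * (1 - 4 * x)
        * (size m * (goodPoly m j).coeff s) := by
        gcongr
        simp
    _ = ((j : ℝ) + 1) * sameTypeSets m j * ((1 - 4 * x)
        * ((1 / size m) ^ j * s.descFactorial j * (goodPoly m j).coeff s)) := by
      rw [rate, div_pow, one_pow, pow_succ]; field_simp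
    _ ≤ ((j : ℝ) + 1) * sameTypeSets m j * ((1 - 4 * x) * (goodPoly m j).coeff (s - j)) := by
      gcongr
    _ ≤ _ := h1

/-! ### The product formula and its exponential approximation -/

/-- Divide the recurrence for good sets by (s + 1) C(N, s + 1) = (N - s) C(N, s), the same
recurrence without spoiling. -/
theorem coeff_goodPoly_div_choose {n : ℕ} {m : Fin n → ℕ} {j : ℕ} (hj : 1 ≤ j)
    (hM : 1 ≤ maxMult m) {t : ℕ} (ht : 16 * (maxShare m * t) ≤ 1) :
    (goodPoly m j).coeff t / ((size m).choose t : ℝ)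
      = ∏ s ∈ Finset.range t, (1 - hazard m j s) := by
  have hN : (0 : ℝ) < size m := by exact_mod_cast hM.trans (maxMult_le_size m)
  induction t with
  | zero => simp [coeff_zero_goodPoly]
  | succ t ih =>
    have hmono := maxShare_mul_mono m (Nat.le_succ t)
    have ht' : 16 * (maxShare m * t) ≤ 1 := by linarith
    have hden := size_sub_mul_coeff_pos hj hM ht'
    have hpos := (goodPoly_crude hj hM t ht').1
    have hlt : t + 1 ≤ size m := by
      have h1 := le_maxShare_mul hM (t + 1)
      have h2 : ((t + 1 : ℕ) : ℝ) ≤ size m := by nlinarith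
      exact_mod_cast h2
    rw [Finset.prod_range_succ, ← ih ht']
    have hrec := succ_mul_coeff_succ_goodPoly m j t
    have hc := Nat.choose_succ_right_eq (size m) t
    have hc' : ((size m).choose (t + 1) : ℝ) * ((t : ℝ) + 1)
        = (size m).choose t * ((size m : ℝ) - t) := by
      have h2 : (((size m).choose (t + 1) * (t + 1) : ℕ) : ℝ)
          = (((size m).choose t * (size m - t) : ℕ) : ℝ) := by rw [hc]
      rw [Nat.cast_mul, Nat.cast_mul, Nat.cast_sub (by omega)] at h2
      push_cast at h2 ⊢
      exact h2
    have hc0 : (0 : ℝ) < (size m).choose (t + 1) := by exact_mod_cast Nat.choose_pos hlt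
    have hc1 : (0 : ℝ) < (size m).choose t := by exact_mod_cast Nat.choose_pos (by omega)
    have hh : (1 - hazard m j t) * (((size m : ℝ) - t) * (goodPoly m j).coeff t)
        = ((t : ℝ) + 1) * (goodPoly m j).coeff (t + 1) := by
      rw [hazard, sub_mul, div_mul_cancel₀ _ hden.ne', hrec, one_mul]
    have ht0 : (0 : ℝ) < (t : ℝ) + 1 := by positivity
    rw [div_mul_eq_mul_div, div_eq_div_iff hc0.ne' hc1.ne']
    refine mul_right_cancel₀ ht0.ne' ?_
    calc (goodPoly m j).coeff (t + 1) * (size m).choose t * ((t : ℝ) + 1)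
        = (size m).choose t * (((t : ℝ) + 1) * (goodPoly m j).coeff (t + 1)) := by ring
      _ = (goodPoly m j).coeff t * (1 - hazard m j t)
          * ((size m).choose t * ((size m : ℝ) - t)) := by rw [← hh]; ring
      _ = _ := by rw [← hc']; ring

/-- Keeps the error from replacing a falling factorial by a power free of λ: that error is of order
(j + 1) rate t^j, hence at most of order x^j ≤ x. -/
theorem succ_mul_rate_le {n : ℕ} {m : Fin n → ℕ} (hM : 1 ≤ maxMult m) (j : ℕ) :
    ((j : ℝ) + 1) * rate m j ≤ maxShare m ^ j := by
  have hN : (0 : ℝ) < size m := by exact_mod_cast hM.trans (maxMult_le_size m)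
  rw [rate, maxShare, ← mul_div_assoc, div_pow, div_le_div_iff₀ (by positivity) (by positivity)]
  calc ((j : ℝ) + 1) * sameTypeSets m j * (size m : ℝ) ^ j
      ≤ size m * (maxMult m : ℝ) ^ j * (size m : ℝ) ^ j := by
        exact mul_le_mul_of_nonneg_right (succ_mul_sameTypeSets_le m j) (by positivity)
    _ = _ := by rw [pow_succ]; ring

theorem abs_coeff_goodPoly_div_sub_exp_le {n : ℕ} {m : Fin n → ℕ} {j : ℕ} (hj : 1 ≤ j)
    (hM : 1 ≤ maxMult m) {t : ℕ} (ht1 : 1 ≤ t)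
    (ht : (17 * 25 ^ (j + 1) + 16) * (maxShare m * t) ≤ 1 / 2) :
    |(goodPoly m j).coeff t / ((size m).choose t : ℝ) - Real.exp (-(rate m j * (t : ℝ) ^ (j + 1)))|
      ≤ Real.exp ((j : ℝ) + 1) * (((j : ℝ) + 1) + 2 * (17 * 25 ^ (j + 1) + 16))
        * (maxShare m * t) := by
  have hμ := maxShare_nonneg m
  have hR := rate_nonneg m j
  set K : ℝ := 25 ^ (j + 1) with hK
  have hK25 : 25 ≤ K := le_self_pow₀ (by norm_num) (by omega)
  set x : ℝ := maxShare m * t with hx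
  have hx0 : 0 ≤ x := by positivity
  have hKx : 0 ≤ K * x := by positivity
  have hx16 : 16 * x ≤ 1 := by linarith
  set lam : ℝ := rate m j * (t : ℝ) ^ (j + 1) with hlam
  set Lam : ℝ := rate m j * t.descFactorial (j + 1) with hLam
  have hLam0 : 0 ≤ Lam := by positivity
  have hLamle : Lam ≤ lam := by
    have : (t.descFactorial (j + 1) : ℝ) ≤ (t : ℝ) ^ (j + 1) := by
      exact_mod_cast Nat.descFactorial_le_pow t (j + 1)
    exact mul_le_mul_of_nonneg_left this hR
  have hdiff : lam - Lam ≤ x * ((j : ℝ) + 1) := by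
    have h1 := pow_succ_sub_descFactorial_succ_le t j ht1
    calc lam - Lam = rate m j * ((t : ℝ) ^ (j + 1) - t.descFactorial (j + 1)) := by
          rw [hlam, hLam]; ring
      _ ≤ rate m j * (((j : ℝ) + 1) ^ 2 * (t : ℝ) ^ j) := by gcongr
      _ = (((j : ℝ) + 1) * rate m j) * (((j : ℝ) + 1) * (t : ℝ) ^ j) := by ring
      _ ≤ maxShare m ^ j * (((j : ℝ) + 1) * (t : ℝ) ^ j) := by
        gcongr; exact succ_mul_rate_le hM j
      _ = x ^ j * ((j : ℝ) + 1) := by rw [hx, mul_pow]; ring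
      _ ≤ x * ((j : ℝ) + 1) := by
        gcongr; exact pow_le_of_le_one hx0 (by linarith) (by omega)
  have hsmall : ∀ s < t, 16 * (maxShare m * s) ≤ 1 := fun s hs => by
    have := maxShare_mul_mono m hs.le
    linarith
  have hsum : ∑ s ∈ Finset.range t, ((j : ℝ) + 1) * rate m j * s.descFactorial j = Lam := by
    rw [← Finset.mul_sum, hLam, ← succ_mul_sum_descFactorial]; ring
  have hup : ∑ s ∈ Finset.range t, hazard m j s ≤ Lam * (1 + K * x) := by
    rw [← hsum, Finset.sum_mul]
    refine Finset.sum_le_sum fun s hs => ?_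
    have hs' := Finset.mem_range.1 hs
    refine (hazard_le_rate hj hM (hsmall s hs')).trans ?_
    have h1 := maxShare_mul_mono m hs'.le
    have h2 : (K - 1) * (maxShare m * s) ≤ K * x :=
      mul_le_mul (by linarith) h1 (by positivity) (by linarith)
    gcongr
  have hlow : Lam * (1 - K * x) ≤ ∑ s ∈ Finset.range t, hazard m j s := by
    rw [← hsum, Finset.sum_mul]
    refine Finset.sum_le_sum fun s hs => ?_
    have hs' := Finset.mem_range.1 hs
    refine le_trans ?_ (rate_le_hazard hj hM (hsmall s hs'))
    have h1 := maxShare_mul_mono m hs'.le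
    have h2 : 4 * (maxShare m * s) ≤ K * x :=
      mul_le_mul (by linarith) h1 (by positivity) (by linarith)
    gcongr
  -- Expanding (1 + 16x)(1 + Kx) leaves x(16 + K + 16Kx), and x ≤ 1 already suffices for the
  -- coefficient 17K + 16.
  have hup2 : ∑ s ∈ Finset.range t, (hazard m j s + 2 * hazard m j s ^ 2)
      ≤ lam + x * (((j : ℝ) + 1) + (17 * K + 16) * lam) := by
    have h1 : ∑ s ∈ Finset.range t, (hazard m j s + 2 * hazard m j s ^ 2)
        ≤ (1 + 16 * x) * ∑ s ∈ Finset.range t, hazard m j s := by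
      rw [Finset.mul_sum]
      refine Finset.sum_le_sum fun s hs => ?_
      have hs' := Finset.mem_range.1 hs
      have h2 := hazard_nonneg hj hM (hsmall s hs')
      have h3 := hazard_le hj hM (hsmall s hs')
      have h4 := maxShare_mul_mono m hs'.le
      have h5 : hazard m j s * hazard m j s ≤ 8 * x * hazard m j s :=
        mul_le_mul_of_nonneg_right (by linarith) h2
      rw [pow_two]; linarith
    have h2 : (1 + 16 * x) * ∑ s ∈ Finset.range t, hazard m j s
        ≤ (1 + 16 * x) * (lam * (1 + K * x)) := by
      gcongr
      exact hup.trans (by gcongr)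
    have h3 : K * lam * x * (16 * x) ≤ K * lam * x * 1 := by gcongr
    have h4 : 0 ≤ K * lam * x := by positivity
    have h5 : 0 ≤ x * ((j : ℝ) + 1) := by positivity
    linarith
  have hlow2 : lam - x * (((j : ℝ) + 1) + (17 * K + 16) * lam)
      ≤ ∑ s ∈ Finset.range t, hazard m j s := by
    have h1 : K * x * Lam ≤ K * x * lam := by gcongr
    have h2 : 0 ≤ K * x * lam := by positivity
    have h3 : 0 ≤ x * lam := by positivity
    linarith
  have hprod := prod_one_sub_le_exp (hazard m j) t (fun s hs => by
    have h3 := hazard_le hj hM (hsmall s hs)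
    have h4 := hsmall s hs
    exact ⟨hazard_nonneg hj hM h4, by linarith⟩)
  rw [← coeff_goodPoly_div_choose hj hM hx16] at hprod
  refine abs_sub_exp_neg_le (by positivity) hx0 (by linarith) (by positivity) (by positivity) ht
    (le_trans (Real.exp_le_exp.2 ?_) hprod.1) (hprod.2.trans (Real.exp_le_exp.2 ?_))
  · linarith
  · linarith

/-! ### Random decks and random subsets of labelled cards -/

theorem card_filter_mem_eq_mul {α β : Type*} [Fintype α] [DecidableEq β] (f : α → β) (S : Finset β)
    (K : ℕ) (h : ∀ b ∈ S, (Finset.univ.filter fun a => f a = b).card = K) :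
    (Finset.univ.filter fun a => f a ∈ S).card = S.card * K := by
  rw [Finset.card_eq_sum_card_fiberwise (f := f) (t := S) (fun a ha => by simpa using ha),
    ← smul_eq_mul, ← Finset.sum_const]
  refine Finset.sum_congr rfl fun b hb => ?_
  rw [← h b hb, Finset.filter_filter]
  congr 1
  ext a
  simp only [Finset.mem_filter, Finset.mem_univ, true_and]
  exact ⟨fun h => h.2, fun h => ⟨h ▸ hb, h⟩⟩

/-- The `N` distinguishable cards of the deck. -/
abbrev Card {n : ℕ} (m : Fin n → ℕ) : Type := Σ i, Fin (m i)

theorem card_card {n : ℕ} (m : Fin n → ℕ) : Fintype.card (Card m) = size m := by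
  simp [Card, size]

/-- The word of types of an ordering of the cards. -/
def typeWord {n : ℕ} {m : Fin n → ℕ} (σ : Fin (size m) ≃ Card m) : Fin (size m) → Fin n :=
  fun s => (σ s).1

/-- The set of the first `t` cards of an ordering of the cards. -/
def bottomCards {n : ℕ} {m : Fin n → ℕ} (t : ℕ) (σ : Fin (size m) ≃ Card m) : Finset (Card m) :=
  (Finset.univ.filter fun s : Fin (size m) => s.val + 1 ≤ t).image σ

theorem typeWord_mem_decks {n : ℕ} {m : Fin n → ℕ} (σ : Fin (size m) ≃ Card m) :
    typeWord σ ∈ decks m := by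
  intro i
  rw [← Fintype.card_fin (m i), ← Finset.card_univ]
  symm
  refine Finset.card_bij (fun k _ => σ.symm ⟨i, k⟩) (fun k _ => ?_)
    (fun a _ b _ h => by simpa using h) (fun s hs => ?_)
  · refine Finset.mem_filter.2 ⟨Finset.mem_univ _, ?_⟩
    rw [typeWord, Equiv.apply_symm_apply]
  have h := (Finset.mem_filter.1 hs).2
  rw [typeWord] at h
  subst h
  exact ⟨(σ s).2, Finset.mem_univ _, by simp⟩

theorem card_bottomCards {n : ℕ} {m : Fin n → ℕ} {t : ℕ} (ht : t ≤ size m)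
    (σ : Fin (size m) ≃ Card m) : (bottomCards t σ).card = t := by
  rw [bottomCards, Finset.card_image_of_injective _ σ.injective]
  have h := Fin.card_filter_val_lt (n := size m) (m := t)
  simpa [Nat.succ_le_iff, ht] using h

theorem countUpTo_typeWord {n : ℕ} {m : Fin n → ℕ} (t : ℕ) (σ : Fin (size m) ≃ Card m)
    (i : Fin n) : countUpTo (typeWord σ) t i
      = (Finset.univ.filter fun k : Fin (m i) => (⟨i, k⟩ : Card m) ∈ bottomCards t σ).card := by
  symm
  refine Finset.card_bij (fun k _ => σ.symm ⟨i, k⟩) (fun k hk => ?_)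
    (fun a _ b _ h => by simpa using h) (fun s hs => ?_)
  · simp only [bottomCards, Finset.mem_filter, Finset.mem_univ, true_and, Finset.mem_image] at hk
    obtain ⟨s, hs, hk⟩ := hk
    refine Finset.mem_filter.2 ⟨Finset.mem_univ _, ?_, ?_⟩
    · rwa [← hk, Equiv.symm_apply_apply]
    · rw [typeWord, Equiv.apply_symm_apply]
  · obtain ⟨hst, h⟩ := (Finset.mem_filter.1 hs).2
    rw [typeWord] at h
    subst h
    refine ⟨(σ s).2, ?_, by simp⟩
    simp only [bottomCards, Finset.mem_filter, Finset.mem_univ, true_and, Finset.mem_image]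
    exact ⟨s, hst, rfl⟩

/-- Two decks differ by a permutation of the positions; precomposing with it matches the orderings
that induce them. -/
theorem card_typeWord_fiber_eq {n : ℕ} {m : Fin n → ℕ} {Y Z : Fin (size m) → Fin n}
    (hY : Y ∈ decks m) (hZ : Z ∈ decks m) :
    (Finset.univ.filter fun σ : Fin (size m) ≃ Card m => typeWord σ = Y).card
      = (Finset.univ.filter fun σ : Fin (size m) ≃ Card m => typeWord σ = Z).card := by
  let e : ∀ i, {s // Z s = i} ≃ {s // Y s = i} := fun i =>
    Fintype.equivOfCardEq (by rw [Fintype.card_subtype, Fintype.card_subtype, hY i, hZ i])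
  let τ : Fin (size m) ≃ Fin (size m) := Equiv.ofFiberEquiv e
  have hτ : ∀ s, Y (τ s) = Z s := Equiv.ofFiberEquiv_map e
  refine Finset.card_nbij' (fun σ => τ.trans σ) (fun σ => τ.symm.trans σ) ?_ ?_ ?_ ?_
  · intro σ hσ
    simp only [Finset.coe_filter, Finset.mem_univ, true_and, Set.mem_ofPred_eq] at hσ ⊢
    funext s
    rw [← hτ s, ← hσ]; rfl
  · intro σ hσ
    simp only [Finset.coe_filter, Finset.mem_univ, true_and, Set.mem_ofPred_eq] at hσ ⊢
    funext s
    have h := hτ (τ.symm s)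
    rw [Equiv.apply_symm_apply] at h
    rw [h, ← hσ]; rfl
  · intro σ _; exact Equiv.ext fun s => by simp
  · intro σ _; exact Equiv.ext fun s => by simp

/-- A permutation of the cards carrying A to B matches the orderings by postcomposition. -/
theorem card_bottomCards_fiber_eq {n : ℕ} {m : Fin n → ℕ} (t : ℕ) {A B : Finset (Card m)}
    (h : A.card = B.card) :
    (Finset.univ.filter fun σ : Fin (size m) ≃ Card m => bottomCards t σ = A).card
      = (Finset.univ.filter fun σ : Fin (size m) ≃ Card m => bottomCards t σ = B).card := by
  let e : {x // x ∈ A} ≃ {x // x ∈ B} := Fintype.equivOfCardEq (by simpa using h)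
  let π : Equiv.Perm (Card m) := e.extendSubtype
  have hπ : A.image π = B := by
    refine Finset.eq_of_subset_of_card_le (fun x hx => ?_) ?_
    · obtain ⟨y, hy, rfl⟩ := Finset.mem_image.1 hx
      exact e.extendSubtype_mem y hy
    · rw [Finset.card_image_of_injective _ π.injective, h]
  have himg : ∀ (ρ : Equiv.Perm (Card m)) (σ : Fin (size m) ≃ Card m),
      bottomCards t (σ.trans ρ) = (bottomCards t σ).image ρ := fun ρ σ => by
    rw [bottomCards, bottomCards, Finset.image_image]; rfl
  refine Finset.card_nbij' (fun σ => σ.trans π) (fun σ => σ.trans π.symm) ?_ ?_ ?_ ?_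
  · intro σ hσ
    simp only [Finset.coe_filter, Finset.mem_univ, true_and, Set.mem_ofPred_eq] at hσ ⊢
    rw [himg, hσ, hπ]
  · intro σ hσ
    simp only [Finset.coe_filter, Finset.mem_univ, true_and, Set.mem_ofPred_eq] at hσ ⊢
    rw [himg, hσ, ← hπ, Finset.image_image]
    simp
  · intro σ _; ext s : 1; simp
  · intro σ _; ext s : 1; simp

/-- The sets of `t` cards with at most `j` cards of each type. -/
def goodSets {n : ℕ} (m : Fin n → ℕ) (j t : ℕ) : Finset (Finset (Card m)) :=
  (Finset.univ.powersetCard t).filter fun A =>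
    ∀ i, (Finset.univ.filter fun k : Fin (m i) => (⟨i, k⟩ : Card m) ∈ A).card ≤ j

theorem truncBinom_eq_sum (j a : ℕ) : truncBinom j a
    = ∑ B ∈ Finset.univ.filter (fun B : Finset (Fin a) => B.card ≤ j), (X : ℝ[X]) ^ B.card := by
  ext k
  rw [coeff_truncBinom, finsetSum_coeff]
  simp only [coeff_X_pow]
  rw [Finset.sum_boole, Finset.filter_filter]
  split_ifs with h
  · have h1 : (Finset.univ.filter fun B : Finset (Fin a) => B.card ≤ j ∧ k = B.card)
        = Finset.univ.powersetCard k := by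
      ext B
      simp only [Finset.mem_filter, Finset.mem_univ, true_and, Finset.mem_powersetCard,
        Finset.subset_univ]
      omega
    rw [h1, Finset.card_powersetCard]; simp
  · rw [Finset.filter_false_of_mem fun B _ => by omega]; simp

/-- A good set amounts to an independent choice of at most j cards within each type; expanding the
product runs over these choices. -/
theorem coeff_goodPoly_eq_card {n : ℕ} (m : Fin n → ℕ) (j t : ℕ) :
    (goodPoly m j).coeff t = (goodSets m j t).card := by
  have h1 : goodPoly m j = ∑ f ∈ Fintype.piFinset fun i =>
      Finset.univ.filter (fun B : Finset (Fin (m i)) => B.card ≤ j),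
      (X : ℝ[X]) ^ ∑ i, (f i).card := by
    rw [goodPoly]
    simp only [truncBinom_eq_sum]
    rw [Finset.prod_univ_sum]
    exact Finset.sum_congr rfl fun f _ => Finset.prod_pow_eq_pow_sum _ _ _
  rw [h1, finsetSum_coeff]
  simp only [coeff_X_pow]
  rw [Finset.sum_boole]
  congr 1
  refine Finset.card_nbij' (fun f => Finset.univ.sigma f)
    (fun A i => Finset.univ.filter fun k => (⟨i, k⟩ : Card m) ∈ A) ?_ ?_ ?_ ?_
  · intro f hf
    simp only [Finset.coe_filter, Fintype.mem_piFinset, Finset.mem_filter, Finset.mem_univ,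
      true_and, Set.mem_ofPred_eq] at hf
    simp only [goodSets, Finset.coe_filter, Finset.mem_powersetCard, Finset.subset_univ,
      true_and, Set.mem_ofPred_eq, Finset.card_sigma, hf.2, Finset.mem_sigma, Finset.mem_univ]
    intro i
    rw [Finset.filter_univ_mem]
    exact hf.1 i
  · intro A hA
    simp only [goodSets, Finset.coe_filter, Finset.mem_powersetCard, Finset.subset_univ,
      true_and, Set.mem_ofPred_eq] at hA
    simp only [Finset.coe_filter, Fintype.mem_piFinset, Finset.mem_filter, Finset.mem_univ,
      true_and, Set.mem_ofPred_eq]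
    refine ⟨hA.2, ?_⟩
    rw [← hA.1, ← Finset.card_sigma]
    congr 1
    ext ⟨i, k⟩
    simp
  · intro f _
    funext i
    ext k
    simp
  · intro A _
    ext ⟨i, k⟩
    simp

/-- Orderings of the labelled cards map to decks and to t-subsets, in both cases with fibres of
constant size. Counting all orderings and the good ones through either map gives the same ratio. -/
theorem card_good_decks {n : ℕ} (m : Fin n → ℕ) (j : ℕ) {t : ℕ} (ht : t ≤ size m)
    (S : Finset (Fin (size m) → Fin n)) (hS : ∀ Z, Z ∈ S ↔ Z ∈ decks m) :
    ((S.filter fun Z => ∀ i, countUpTo Z t i ≤ j).card : ℝ) / S.card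
      = (goodPoly m j).coeff t / ((size m).choose t : ℝ) := by
  obtain ⟨σ₀⟩ : Nonempty (Fin (size m) ≃ Card m) :=
    ⟨Fintype.equivOfCardEq (by rw [card_card, Fintype.card_fin])⟩
  set K := (Finset.univ.filter fun σ : Fin (size m) ≃ Card m => typeWord σ = typeWord σ₀).card
    with hK
  set K' := (Finset.univ.filter fun σ : Fin (size m) ≃ Card m =>
    bottomCards t σ = bottomCards t σ₀).card with hK'
  have hK0 : (0 : ℝ) < K := by
    exact_mod_cast Finset.card_pos.2 ⟨σ₀, by simp⟩
  have hK0' : (0 : ℝ) < K' := by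
    exact_mod_cast Finset.card_pos.2 ⟨σ₀, by simp⟩
  have hZ : ∀ Z ∈ S, (Finset.univ.filter fun σ : Fin (size m) ≃ Card m => typeWord σ = Z).card
      = K := fun Z hZ => card_typeWord_fiber_eq ((hS Z).1 hZ) (typeWord_mem_decks σ₀)
  have hA : ∀ A ∈ (Finset.univ : Finset (Card m)).powersetCard t,
      (Finset.univ.filter fun σ : Fin (size m) ≃ Card m => bottomCards t σ = A).card = K' :=
    fun A hA => card_bottomCards_fiber_eq t
      (by rw [(Finset.mem_powersetCard.1 hA).2, card_bottomCards ht])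
  have e1 := card_filter_mem_eq_mul typeWord S K hZ
  have e2 := card_filter_mem_eq_mul typeWord (S.filter fun Z => ∀ i, countUpTo Z t i ≤ j) K
    (fun Z h => hZ Z (Finset.mem_filter.1 h).1)
  have e3 := card_filter_mem_eq_mul (bottomCards t) _ K' hA
  have e4 := card_filter_mem_eq_mul (bottomCards t) (goodSets m j t) K'
    (fun A h => hA A (Finset.mem_filter.1 h).1)
  have e13 : S.card * K = (size m).choose t * K' := by
    have hc : (size m).choose t = ((Finset.univ : Finset (Card m)).powersetCard t).card := by
      rw [Finset.card_powersetCard, Finset.card_univ, card_card]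
    rw [← e1, hc, ← e3]
    congr 1
    ext σ
    simp [hS, typeWord_mem_decks, card_bottomCards ht]
  have e24 : (S.filter fun Z => ∀ i, countUpTo Z t i ≤ j).card * K
      = (goodSets m j t).card * K' := by
    rw [← e2, ← e4]
    congr 1
    ext σ
    simp [goodSets, hS, typeWord_mem_decks, card_bottomCards ht, countUpTo_typeWord]
  have e13' : (S.card : ℝ) * K = (size m).choose t * K' := by exact_mod_cast e13
  have e24' : ((S.filter fun Z => ∀ i, countUpTo Z t i ≤ j).card : ℝ) * K
      = (goodSets m j t).card * K' := by exact_mod_cast e24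
  rw [coeff_goodPoly_eq_card, ← mul_div_mul_right _ _ hK0.ne', e13', e24',
    mul_div_mul_right _ _ hK0'.ne']

/-! ### The law of T_j -/

theorem le_lastTime_iff {n N : ℕ} (Z : Fin N → Fin n) (j : ℕ) {t : ℕ} (ht1 : 1 ≤ t)
    (ht : t ≤ N) : t ≤ lastTime Z j ↔ ∀ i, countUpTo Z t i ≤ j := by
  -- The supremum of an empty set is 0, so t ≥ 1 is needed here. Monotonicity of the counts in t
  -- does the rest.
  rw [lastTime, Finset.le_sup_iff (by simpa [Nat.succ_le_iff] using ht1)]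
  constructor
  · rintro ⟨b, hb, htb⟩ i
    refine le_trans (Finset.card_le_card fun s hs => ?_) ((Finset.mem_filter.1 hb).2 i)
    simp only [Finset.mem_filter, Finset.mem_univ, true_and] at hs ⊢
    exact ⟨hs.1.trans htb, hs.2⟩
  · intro h
    exact ⟨t, Finset.mem_filter.2 ⟨Finset.mem_Icc.2 ⟨ht1, ht⟩, h⟩, le_rfl⟩

theorem deckMeasure_real_le_lastTime {n : ℕ} (m : Fin n → ℕ) (j : ℕ) {t : ℕ} (ht1 : 1 ≤ t)
    (ht : t ≤ size m) : (deckMeasure m).real {Z | t ≤ lastTime Z j}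
      = (goodPoly m j).coeff t / ((size m).choose t : ℝ) := by
  classical
  set S : Finset (Fin (size m) → Fin n) := Finset.univ.filter (· ∈ decks m) with hSdef
  have hS : ∀ Z, Z ∈ S ↔ Z ∈ decks m := fun Z => by simp [hSdef]
  rw [← card_good_decks m j ht S hS]
  have h1 : decks m = (S : Set (Fin (size m) → Fin n)) := by ext Z; simp [hSdef]
  have h2 : {Z : Fin (size m) → Fin n | t ≤ lastTime Z j}
      = ((Finset.univ.filter fun Z => ∀ i, countUpTo Z t i ≤ j :
        Finset (Fin (size m) → Fin n)) : Set (Fin (size m) → Fin n)) := by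
    ext Z
    simp [le_lastTime_iff Z j ht1 ht]
  rw [MeasureTheory.Measure.real, deckMeasure, h1, h2, ProbabilityTheory.uniformOn_apply_finset,
    ENNReal.toReal_div, ENNReal.toReal_natCast, ENNReal.toReal_natCast]
  congr 3
  ext Z
  simp

/-! ### Consequences of the hypotheses on the multiplicities -/

theorem rate_eq_beta {n : ℕ} {m : Fin n → ℕ} (hn : 0 < n) (hM : 1 ≤ maxMult m) (j : ℕ) :
    rate m j = beta m (j + 1) / (n : ℝ) ^ j := by
  have hN : (0 : ℝ) < size m := by exact_mod_cast hM.trans (maxMult_le_size m)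
  have hn' : (0 : ℝ) < n := by exact_mod_cast hn
  rw [rate, beta, ← Finset.mul_sum, avgMult, sameTypeSets, div_pow, pow_succ (n : ℝ)]
  field_simp

/-- The constant in the lower bound of `choose a (j + 1)` by a multiple of `a ^ (j + 1)`. -/
noncomputable def chooseConst (j : ℕ) : ℝ := 1 / (((j : ℝ) + 1) ^ (j + 1) * ((j + 1).factorial : ℝ))

theorem chooseConst_pos (j : ℕ) : 0 < chooseConst j := by unfold chooseConst; positivity

/-- For a ≥ j + 1 one has a - j ≥ a / (j + 1), and C(a, j + 1) ≥ (a - j)^(j+1) / (j + 1)!. -/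
theorem chooseConst_mul_pow_le {j a : ℕ} (h : j + 1 ≤ a) :
    chooseConst j * (a : ℝ) ^ (j + 1) ≤ (a.choose (j + 1) : ℝ) := by
  refine le_trans ?_ (Nat.pow_le_choose (α := ℝ) (j + 1) a)
  obtain ⟨d, rfl⟩ := Nat.exists_eq_add_of_le h
  rw [show j + 1 + d + 1 - (j + 1) = d + 1 by omega, chooseConst, div_mul_eq_mul_div, one_mul,
    div_le_div_iff₀ (by positivity) (by positivity)]
  have h1 : ((j + 1 + d : ℕ) : ℝ) ≤ ((j : ℝ) + 1) * ((d : ℝ) + 1) := by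
    push_cast
    have : (0 : ℝ) ≤ j * d := by positivity
    linarith
  calc ((j + 1 + d : ℕ) : ℝ) ^ (j + 1) * ((j + 1).factorial : ℝ)
      ≤ (((j : ℝ) + 1) * ((d : ℝ) + 1)) ^ (j + 1) * ((j + 1).factorial : ℝ) := by gcongr
    _ = _ := by rw [mul_pow]; push_cast; ring

/-- Types with m_i ≥ j + 1 hold at least ε N cards; the power mean inequality over all n types
bounds the sum of m_i^(j+1) over those types from below. -/
theorem le_beta {n : ℕ} {m : Fin n → ℕ} {j : ℕ} {ε : ℝ} (hε : 0 < ε) (hn : 0 < n)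
    (hM : j + 1 ≤ maxMult m) (hc : ε ≤ cardFraction m (j + 1)) :
    chooseConst j * ε ^ (j + 1) ≤ beta m (j + 1) := by
  have hN : (0 : ℝ) < size m := by
    exact_mod_cast (Nat.le_add_left 1 j).trans (hM.trans (maxMult_le_size m))
  have hn' : (0 : ℝ) < n := by exact_mod_cast hn
  have hcc := chooseConst_pos j
  set f : Fin n → ℝ := fun i => if j + 1 ≤ m i then (m i : ℝ) else 0 with hf
  have hf0 : ∀ i ∈ Finset.univ, 0 ≤ f i := fun i _ => by simp only [hf]; split_ifs <;> positivity
  have hsum : cardFraction m (j + 1) = (∑ i, f i) / size m := by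
    rw [cardFraction, Finset.sum_filter, Nat.cast_sum]
    simp [hf]
  have h1 := pow_sum_div_card_le_sum_pow hf0 j
  rw [Finset.card_univ, Fintype.card_fin] at h1
  have h2 : ∀ i, chooseConst j * f i ^ (j + 1) ≤ ((m i).choose (j + 1) : ℝ) := fun i => by
    simp only [hf]
    split_ifs with h
    · exact chooseConst_mul_pow_le h
    · simp
  have h3 : chooseConst j * ∑ i, f i ^ (j + 1) ≤ sameTypeSets m j := by
    rw [Finset.mul_sum]; exact Finset.sum_le_sum fun i _ => h2 i
  have h4 : ε * size m ≤ ∑ i, f i := (le_div_iff₀ hN).1 (hsum ▸ hc)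
  have h5 : beta m (j + 1) = (n : ℝ) ^ j * rate m j := by
    rw [rate_eq_beta hn ((Nat.le_add_left 1 j).trans hM)]; field_simp
  rw [h5, rate, ← mul_div_assoc, le_div_iff₀ (by positivity)]
  calc chooseConst j * ε ^ (j + 1) * (size m : ℝ) ^ (j + 1)
      = chooseConst j * (ε * size m) ^ (j + 1) := by rw [mul_pow]; ring
    _ ≤ chooseConst j * (∑ i, f i) ^ (j + 1) := by gcongr
    _ = (n : ℝ) ^ j * (chooseConst j * ((∑ i, f i) ^ (j + 1) / (n : ℝ) ^ j)) := by field_simp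
    _ ≤ (n : ℝ) ^ j * (chooseConst j * ∑ i, f i ^ (j + 1)) := by gcongr
    _ ≤ (n : ℝ) ^ j * sameTypeSets m j := by gcongr

theorem cardFraction_antitone {n : ℕ} (m : Fin n → ℕ) : Antitone (cardFraction m) := by
  intro a b h
  unfold cardFraction
  refine div_le_div_of_nonneg_right ?_ (by positivity)
  exact_mod_cast Finset.sum_le_sum_of_subset fun i hi => by
    simp only [Finset.mem_filter, Finset.mem_univ, true_and] at hi ⊢
    exact h.trans hi

theorem maxShare_le {n : ℕ} {m : Fin n → ℕ} {ε : ℝ} (hε : 0 < ε) (hn : 0 < n)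
    (hM : 1 ≤ maxMult m) (h : ε * (maxMult m : ℝ) ≤ avgMult m) :
    maxShare m ≤ 1 / (ε * n) := by
  have hN : (0 : ℝ) < size m := by exact_mod_cast hM.trans (maxMult_le_size m)
  have hn' : (0 : ℝ) < n := by exact_mod_cast hn
  rw [avgMult, le_div_iff₀ hn'] at h
  rw [maxShare, div_le_div_iff₀ hN (by positivity)]
  linarith

end CardDeck

/-! ### Assembling the theorem -/

theorem mainTheorem2 (j : ℕ) (hj : 1 ≤ j) (ε : ℝ) (hε : 0 < ε) :
    ∃ C₁ > (0 : ℝ), ∃ C₂ > (0 : ℝ),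
      ∀ (n : ℕ) (m : Fin n → ℕ) (t : ℕ) (lam : ℝ),
        j + 1 ≤ CardDeck.maxMult m →
        1 ≤ t → t ≤ CardDeck.size m →
        ε * (CardDeck.maxMult m : ℝ) ≤ CardDeck.avgMult m →
        ε ≤ CardDeck.cardFraction m (min (2 * j + 1) (CardDeck.maxMult m)) →
        lam = (t : ℝ) ^ (j + 1) / (n : ℝ) ^ j * CardDeck.beta m (j + 1) →
        |(CardDeck.deckMeasure m).real {Z | t ≤ CardDeck.lastTime Z j} - Real.exp (-lam)|
            ≤ C₁ * ((t : ℝ) / (n : ℝ)) ∧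
          C₁ * ((t : ℝ) / (n : ℝ)) ≤ C₂ * (lam / (n : ℝ)) ^ ((1 : ℝ) / ((j : ℝ) + 1)) := by
  set K : ℝ := 17 * 25 ^ (j + 1) + 16 with hK
  have hK0 : 0 < K := by positivity
  set A : ℝ := Real.exp ((j : ℝ) + 1) * (((j : ℝ) + 1) + 2 * K) with hA
  have hA0 : 0 < A := by positivity
  have hAK : 2 * K ≤ A := by
    have h1 : 1 ≤ Real.exp ((j : ℝ) + 1) := Real.one_le_exp (by positivity)
    have h2 : 2 * K ≤ ((j : ℝ) + 1) + 2 * K := by linarith [Nat.cast_nonneg (α := ℝ) j]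
    exact h2.trans (le_mul_of_one_le_left (by positivity) h1)
  set b : ℝ := CardDeck.chooseConst j * ε ^ (j + 1) with hb
  have hcc := CardDeck.chooseConst_pos j
  have hb0 : 0 < b := by positivity
  set p : ℝ := (1 : ℝ) / ((j : ℝ) + 1) with hp
  have hbp : 0 < b ^ p := Real.rpow_pos_of_pos hb0 p
  -- The factor 1/ε comes from m*/N ≤ 1/(ε n), and b^p from β_{j+1} ≥ b after taking (j + 1)-th
  -- roots.
  refine ⟨A / ε, by positivity, A / ε / b ^ p, by positivity, ?_⟩
  intro n m t lam hM ht1 htN hshare hfrac hlam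
  have hn : 0 < n := by
    rcases Nat.eq_zero_or_pos n with rfl | h
    · simp [CardDeck.maxMult] at hM
    · exact h
  have hn' : (0 : ℝ) < n := by exact_mod_cast hn
  have hM1 : 1 ≤ CardDeck.maxMult m := (Nat.le_add_left 1 j).trans hM
  have hμ := CardDeck.maxShare_nonneg m
  -- Only multiplicity at least j + 1 is used, and min(2j + 1, m*) ≥ j + 1.
  have hfrac' : ε ≤ CardDeck.cardFraction m (j + 1) :=
    hfrac.trans (CardDeck.cardFraction_antitone m (le_min (by omega) hM))
  have hbeta : b ≤ CardDeck.beta m (j + 1) := CardDeck.le_beta hε hn hM hfrac'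
  have hlam' : lam = CardDeck.rate m j * (t : ℝ) ^ (j + 1) := by
    rw [hlam, CardDeck.rate_eq_beta hn hM1]; ring
  constructor
  · have hx : CardDeck.maxShare m * t ≤ 1 / ε * ((t : ℝ) / n) := by
      have := CardDeck.maxShare_le hε hn hM1 hshare
      calc CardDeck.maxShare m * t ≤ 1 / (ε * n) * t := by gcongr
        _ = _ := by field_simp
    have hgoal : A * (CardDeck.maxShare m * t) ≤ A / ε * ((t : ℝ) / n) := by
      calc A * (CardDeck.maxShare m * t) ≤ A * (1 / ε * ((t : ℝ) / n)) := by gcongr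
        _ = _ := by ring
    refine le_trans ?_ hgoal
    -- If K x > 1/2, then A x ≥ 2 K x > 1 exceeds any difference of two numbers in [0, 1].
    rcases le_or_gt (K * (CardDeck.maxShare m * t)) (1 / 2) with hs | hs
    · rw [CardDeck.deckMeasure_real_le_lastTime m j ht1 htN, hlam']
      exact CardDeck.abs_coeff_goodPoly_div_sub_exp_le hj hM1 ht1 hs
    · have hlam0 : 0 ≤ lam := by
        rw [hlam']; exact mul_nonneg (CardDeck.rate_nonneg m j) (by positivity)
      have h1 : (CardDeck.deckMeasure m).real {Z | t ≤ CardDeck.lastTime Z j} ≤ 1 :=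
        MeasureTheory.measureReal_le_one
      have h2 : 0 ≤ (CardDeck.deckMeasure m).real {Z | t ≤ CardDeck.lastTime Z j} :=
        MeasureTheory.measureReal_nonneg
      have h3 : Real.exp (-lam) ≤ 1 := Real.exp_le_one_iff.2 (by linarith)
      have h4 := Real.exp_pos (-lam)
      have h5 : 2 * K * (CardDeck.maxShare m * t) ≤ A * (CardDeck.maxShare m * t) := by gcongr
      rw [abs_le]
      constructor <;> linarith
  · have h1 : ((t : ℝ) / n) ^ (j + 1) * b ≤ lam / n := by
      calc ((t : ℝ) / n) ^ (j + 1) * b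
          ≤ ((t : ℝ) / n) ^ (j + 1) * CardDeck.beta m (j + 1) := by gcongr
        _ = lam / n := by rw [hlam, div_pow, pow_succ (n : ℝ)]; field_simp
    have h2 : ((t : ℝ) / n) * b ^ p ≤ (lam / n) ^ p := by
      have h3 := Real.rpow_le_rpow (by positivity) h1 (show 0 ≤ p by positivity)
      rw [Real.mul_rpow (by positivity) hb0.le] at h3
      have h4 : (((t : ℝ) / n) ^ (j + 1)) ^ p = (t : ℝ) / n := by
        have := Real.pow_rpow_inv_natCast (x := (t : ℝ) / n) (by positivity)
          (Nat.succ_ne_zero j)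
        rw [hp, one_div]
        simpa using this
      rwa [h4] at h3
    calc A / ε * ((t : ℝ) / n) = A / ε / b ^ p * (((t : ℝ) / n) * b ^ p) := by field_simp
      _ ≤ _ := by gcongr
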